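/- Let $d\ge 1$ and $n\ge 0$ be integers, let $V=\mathbb{C}^n$ with standard basis $(y_1,\dots,y_n)$ and dual basis $(x_1,\dots,x_n)$, and let $W=G(d,1,n)\subset \mathrm{GL}_n(\mathbb{C})$ be the group of monomial matrices whose nonzero entries are $d$-th roots of unity. Let $\mathrm{Ref}(W)$ be the set of pseudo-reflections of $W$ (the $s\in W$ with $s-\mathrm{id}_V$ of rank $1$), for each $s\in\mathrm{Ref}(W)$ choose $\alpha_s\in V^*$ with $\ker\alpha_s=\ker(s-\mathrm{id}_V)$, and let $\mathbf{c}\colon\mathrm{Ref}(W)\to\mathbb{C}$, $s\mapsto c_s$, be a function invariant under conjugation by $W$. For a field $K\supseteq\mathbb{C}$, a $K$-subalgebra $B\subseteq KW$ and a simple $B$-module $L$, put \[ \gamma_L^{B}=\sum_{\chi\in\mathrm{Irr}(W)}\bigl[\mathrm{Res}_{B}(K\otimes_{\mathbb{C}}V_\chi):L\bigr]\,\chi , \] where $\mathrm{Irr}(W)$ is the set of irreducible complex characters of $W$, $V_\chi$ is a complex representation affording $\chi$, and $[X:L]$ is the multiplicity of $L$ as a composition factor of $X$. The characters $\gamma_L^{B}$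 are called the cellular characters for $B$. (i) For $y\in V$ let \[ \mathcal{D}_y=\sum_{s\in\mathrm{Ref}(W)}c_s\det(s)\,\frac{\langle y,\alpha_s\rangle}{\alpha_s}\,s , \] an element of the group algebra of $W$ with coefficients in $\mathbb{C}[V^{\mathrm{reg}}]\subset\mathbb{C}(V)$, where $V^{\mathrm{reg}}$ is the complement in $V$ of the reflecting hyperplanes of $W$. The Gaudin algebra $\mathrm{Gau}_{\mathbf{c}}(W)$ is the $\mathbb{C}[V]$-algebra generated by the $\mathcal{D}_y$, $y\in V$. The Calogero–Moser $\mathbf{c}$-cellular characters of $W$ are the cellular characters for $B=\mathbb{C}(V)\,\mathrm{Gau}_{\mathbf{c}}(W)\subseteq\mathbb{C}(V)W$ (with $K=\mathbb{C}(V)$). (ii) For $0\le k\le n$ identify $G(d,1,k)$ with the subgroup of $G(d,1,n)$ fixing $y_{k+1},\dots,y_n$, and let $\mathbf{eu}_{\mathbf{c},k}=\sum_{s\in\mathrm{Ref}(G(d,1,k))}c_s\det(s)\,s\in\mathbb{C}W$. For $1\le k\le n$ let $J_k=\mathbf{eu}_{\mathbf{c},k}-\mathbf{eu}_{\mathbf{c},k-1}$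 be the Jucys–Murphy elements, and let $\mathbf{JM}_{\mathbf{c}}(d,n)$ be the subalgebra of $\mathbb{C}W$ generated by $J_1,\dots,J_n$. Then every cellular character for $\mathbf{JM}_{\mathbf{c}}(d,n)$ (with $K=\mathbb{C}$) is a finite sum, repetitions allowed, of Calogero–Moser $\mathbf{c}$-cellular characters of $G(d,1,n)$. -/

import Mathlib

open scoped TensorProduct

noncomputable section

namespace CalogeroMoser

/-! ### Jordan–Hölder multiplicities -/

/-- The number of successive quotients of the series of submodules `s` isomorphic to `L`. -/
def factorCount {B X : Type*} [Ring B] [AddCommGroup X] [Module B X]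
    (L : Type*) [AddCommGroup L] [Module B L] (s : CompositionSeries (Submodule B X)) : ℕ :=
  Nat.card {i : Fin s.length //
    Nonempty ((s i.succ ⧸ (s i.castSucc).comap (s i.succ).subtype) ≃ₗ[B] L)}

/-- Independence of the composition series (Jordan–Hölder). -/
theorem factorCount_eq {B X : Type*} [Ring B] [AddCommGroup X] [Module B X]
    (L : Type*) [AddCommGroup L] [Module B L] (s t : CompositionSeries (Submodule B X))
    (hb : s.head = t.head) (ht : s.last = t.last) : factorCount L s = factorCount L t := by
  obtain ⟨f, hf⟩ := CompositionSeries.jordan_holder s t hb ht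
  refine Nat.card_congr (f.subtypeEquiv fun i => ?_)
  have e := (hf i).linearEquiv
  exact ⟨fun ⟨g⟩ => ⟨e.symm.trans g⟩, fun ⟨g⟩ => ⟨e.trans g⟩⟩

open Classical in
/-- The multiplicity `[X : L]` of a simple `B`-module `L` in a `B`-module `X` of finite length:
the number of factors isomorphic to `L` in a composition series of `X`
(and `0` if `X` has no composition series). -/
def mult (B X L : Type*) [Ring B] [AddCommGroup X] [Module B X]
    [AddCommGroup L] [Module B L] : ℕ :=
  if h : ∃ s : CompositionSeries (Submodule B X), s.head = ⊥ ∧ s.last = ⊤ then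
    factorCount L h.choose
  else 0

theorem mult_eq {B X L : Type*} [Ring B] [AddCommGroup X] [Module B X]
    [AddCommGroup L] [Module B L] (s : CompositionSeries (Submodule B X))
    (hb : s.head = ⊥) (ht : s.last = ⊤) : mult B X L = factorCount L s := by
  have h : ∃ s : CompositionSeries (Submodule B X), s.head = ⊥ ∧ s.last = ⊤ := ⟨s, hb, ht⟩
  rw [mult, dif_pos h]
  exact factorCount_eq L _ _ (h.choose_spec.1.trans hb.symm) (h.choose_spec.2.trans ht.symm)

/-! ### Irreducible complex characters -/

/-- `Irr(G)`: the set of characters of irreducible complex (matrix) representations of `G`. -/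
def Irr (G : Type) [Group G] : Set (G → ℂ) :=
  {χ | ∃ (m : ℕ) (ρ : Representation ℂ G (Fin m → ℂ)), ρ.IsIrreducible ∧ ρ.character = χ}

/-- The dimension of the chosen representation affording `χ`. -/
def irrDim {G : Type} [Group G] (χ : Irr G) : ℕ := χ.2.choose

/-- A representation `V_χ` affording the character `χ`. -/
def irrRep {G : Type} [Group G] (χ : Irr G) : Representation ℂ G (Fin (irrDim χ) → ℂ) :=
  χ.2.choose_spec.choose

theorem irrRep_isIrreducible {G : Type} [Group G] (χ : Irr G) : (irrRep χ).IsIrreducible :=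
  χ.2.choose_spec.choose_spec.1

theorem irrRep_character {G : Type} [Group G] (χ : Irr G) : (irrRep χ).character = χ :=
  χ.2.choose_spec.choose_spec.2

/-- A finite group has finitely many irreducible complex characters. -/
instance irrFinite (G : Type) [Group G] [Finite G] : Finite (Irr G) := by
  classical
  have : Fintype G := Fintype.ofFinite G
  have hne : (Nat.card G : ℂ) ≠ 0 := Nat.cast_ne_zero.mpr Nat.card_pos.ne'
  have : Invertible (Nat.card G : ℂ) := invertibleOfNonzero hne
  have key : ∀ χ ψ : Irr G,
      (Nat.card G : ℂ)⁻¹ * ∑ g : G, (χ : G → ℂ) g * (ψ : G → ℂ) g⁻¹ = if χ = ψ then 1 else 0 := by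
    intro χ ψ
    have := irrRep_isIrreducible χ
    have := irrRep_isIrreducible ψ
    have h := Representation.char_orthonormal (irrRep χ) (irrRep ψ)
    rw [irrRep_character χ, irrRep_character ψ] at h
    rw [h]
    by_cases e : χ = ψ
    · subst e
      rw [if_pos rfl, if_pos ⟨Representation.Equiv.refl _⟩]
    · rw [if_neg e]
      by_cases hn : Nonempty (Representation.Equiv (irrRep ψ) (irrRep χ))
      · obtain ⟨φ⟩ := hn
        refine absurd (Subtype.ext ?_) e
        rw [← irrRep_character χ, ← irrRep_character ψ]
        exact (Representation.char_iso φ).symm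
      · rw [if_neg hn]
  have li : LinearIndependent ℂ (fun χ : Irr G => (χ : G → ℂ)) := by
    rw [linearIndependent_iff']
    intro s a ha ψ hψ
    have h : (Nat.card G : ℂ)⁻¹ * ∑ g : G, (∑ χ ∈ s, a χ • (χ : G → ℂ)) g * (ψ : G → ℂ) g⁻¹
        = a ψ := by
      calc _ = ∑ χ ∈ s, a χ * ((Nat.card G : ℂ)⁻¹ *
              ∑ g : G, (χ : G → ℂ) g * (ψ : G → ℂ) g⁻¹) := by
            simp only [Finset.sum_apply, Pi.smul_apply, smul_eq_mul, Finset.sum_mul,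
              Finset.mul_sum]
            rw [Finset.sum_comm]
            refine Finset.sum_congr rfl fun _ _ => Finset.sum_congr rfl fun _ _ => ?_
            ring
        _ = a ψ := by
            simp only [key, mul_ite, mul_one, mul_zero]
            rw [Finset.sum_ite_eq' s ψ a, if_pos hψ]
    rw [ha] at h
    simpa using h.symm
  exact li.finite

/-! ### Cellular characters of a subalgebra of a group algebra -/

/-- Extension of scalars of a complex representation to a field `K ⊇ ℂ`. -/
def extendScalars (K : Type*) [Field K] [Algebra ℂ K] {G V : Type*} [Group G]
    [AddCommGroup V] [Module ℂ V] (ρ : Representation ℂ G V) : Representation K G (K ⊗[ℂ] V) where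
  toFun g := (ρ g).baseChange K
  map_one' := by rw [map_one]; exact LinearMap.baseChange_one ..
  map_mul' g h := by rw [map_mul]; exact LinearMap.baseChange_mul ..

/-- For a field `K ⊇ ℂ`, a `K`-subalgebra `B` of the group algebra `K G` and a simple
`B`-module `L`, the class function
`γ_L = ∑_{χ ∈ Irr(G)} [Res_B (K ⊗ V_χ) : L] χ`. -/
def cellularCharacter {K : Type} [Field K] [Algebra ℂ K] {G : Type} [Group G]
    (B : Subalgebra K (MonoidAlgebra K G)) (L : Type) [AddCommGroup L] [Module B L] : G → ℂ :=
  ∑ᶠ χ : Irr G, (mult B (extendScalars K (irrRep χ)).asModule L) • (χ : G → ℂ)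

/-- `γ` is a cellular character for `B`: it is `γ_L` for some simple `B`-module `L`. -/
def IsCellularCharacter {K : Type} [Field K] [Algebra ℂ K] {G : Type} [Group G]
    (B : Subalgebra K (MonoidAlgebra K G)) (γ : G → ℂ) : Prop :=
  ∃ (L : Type) (_ : AddCommGroup L) (_ : Module B L),
    IsSimpleModule B L ∧ γ = cellularCharacter B L

/-! ### Reflections and the Gaudin algebra -/

/-- The matrix of an element of `W ⊆ GL_n(ℂ)`, acting on `V = ℂⁿ` by `Matrix.mulVec`. -/
def toMatrix {n : ℕ} {W : Subgroup (GL (Fin n) ℂ)} (w : W) : Matrix (Fin n) (Fin n) ℂ :=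
  ((w : GL (Fin n) ℂ) : Matrix (Fin n) (Fin n) ℂ)

/-- `Ref(W)`: the pseudo-reflections in `W`, i.e. the `s` with `s - id_V` of rank one. -/
def Ref {n : ℕ} (W : Subgroup (GL (Fin n) ℂ)) : Set W :=
  {s | (toMatrix s - 1).rank = 1}

/-- `α` chooses, for each reflection `s`, a linear form `α_s` with `ker α_s = ker (s - id_V)`. -/
def IsRootChoice {n : ℕ} (W : Subgroup (GL (Fin n) ℂ))
    (α : Ref W → Module.Dual ℂ (Fin n → ℂ)) : Prop :=
  ∀ s : Ref W, LinearMap.ker (α s) = LinearMap.ker (Matrix.mulVecLin (toMatrix s.1 - 1))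

/-- `c : Ref(W) → ℂ` is invariant under conjugation by `W`. -/
def IsConjInvariant {n : ℕ} {W : Subgroup (GL (Fin n) ℂ)} (c : Ref W → ℂ) : Prop :=
  ∀ s t : Ref W, IsConj (s : W) (t : W) → c s = c t

/-- `ℂ[V] = ℂ[x₁, …, xₙ]`. -/
abbrev PolyV (n : ℕ) : Type := MvPolynomial (Fin n) ℂ

/-- `ℂ(V)`, the fraction field of `ℂ[V]`. -/
abbrev RatV (n : ℕ) : Type := FractionRing (PolyV n)

/-- A linear form on `V`, seen as an element of `ℂ[V]`. -/
def linearFormToPoly {n : ℕ} (a : Module.Dual ℂ (Fin n → ℂ)) : PolyV n :=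
  ∑ i, MvPolynomial.C (a (Pi.single i 1)) * MvPolynomial.X i

/-- `𝒟_y = ∑_{s ∈ Ref(W)} c_s det(s) (⟨y, α_s⟩ / α_s) s`. Its coefficients lie in
`ℂ[V^reg] ⊆ ℂ(V)`; we regard it as an element of the group algebra of `W` over `ℂ(V)`. -/
def gaudinOperator {n : ℕ} (W : Subgroup (GL (Fin n) ℂ)) (c : Ref W → ℂ)
    (α : Ref W → Module.Dual ℂ (Fin n → ℂ)) (y : Fin n → ℂ) : MonoidAlgebra (RatV n) W :=
  ∑ᶠ s : Ref W, MonoidAlgebra.single (s : W)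
    (algebraMap (PolyV n) (RatV n)
        (MvPolynomial.C (c s * (toMatrix s.1).det * α s y)) /
      algebraMap (PolyV n) (RatV n) (linearFormToPoly (α s)))

/-- The Gaudin algebra: the `ℂ[V]`-subalgebra generated by the `𝒟_y`, `y ∈ V`. -/
def gaudinAlgebra {n : ℕ} (W : Subgroup (GL (Fin n) ℂ)) (c : Ref W → ℂ)
    (α : Ref W → Module.Dual ℂ (Fin n → ℂ)) : Subalgebra (PolyV n) (MonoidAlgebra (RatV n) W) :=
  Algebra.adjoin (PolyV n) (Set.range (gaudinOperator W c α))

/-- `ℂ(V) Gau_c(W)`, the `ℂ(V)`-subalgebra of `ℂ(V) W` generated by the Gaudin algebra. -/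
def gaudinAlgebraRat {n : ℕ} (W : Subgroup (GL (Fin n) ℂ)) (c : Ref W → ℂ)
    (α : Ref W → Module.Dual ℂ (Fin n → ℂ)) : Subalgebra (RatV n) (MonoidAlgebra (RatV n) W) :=
  Algebra.adjoin (RatV n) (gaudinAlgebra W c α : Set (MonoidAlgebra (RatV n) W))

/-- The Calogero–Moser `c`-cellular characters of `W`. -/
def IsCMCellularCharacter {n : ℕ} (W : Subgroup (GL (Fin n) ℂ)) (c : Ref W → ℂ)
    (α : Ref W → Module.Dual ℂ (Fin n → ℂ)) (γ : W → ℂ) : Prop :=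
  IsCellularCharacter (gaudinAlgebraRat W c α) γ

/-! ### The group `G(d,1,n)` and its Jucys–Murphy elements -/

/-- The monomial matrix with entry `a j` at position `(σ j, j)`. -/
def monomialMatrix {n : ℕ} (σ : Equiv.Perm (Fin n)) (a : Fin n → ℂˣ) :
    Matrix (Fin n) (Fin n) ℂ :=
  Matrix.of fun i j => if i = σ j then (a j : ℂ) else 0

theorem monomialMatrix_one {n : ℕ} : monomialMatrix (1 : Equiv.Perm (Fin n)) 1 = 1 := by
  ext i j
  change (if i = j then (1 : ℂ) else 0) = _
  rw [Matrix.one_apply]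

theorem monomialMatrix_mul {n : ℕ} (σ τ : Equiv.Perm (Fin n)) (a b : Fin n → ℂˣ) :
    monomialMatrix σ a * monomialMatrix τ b =
      monomialMatrix (σ * τ) (fun j => a (τ j) * b j) := by
  ext i j
  simp only [monomialMatrix, Matrix.mul_apply, Matrix.of_apply, Units.val_mul]
  rw [Finset.sum_eq_single (τ j)]
  · rw [if_pos rfl]
    by_cases h : i = (σ * τ) j
    · rw [if_pos h, if_pos (show i = σ (τ j) from h)]
    · rw [if_neg h, if_neg (show ¬i = σ (τ j) from h), zero_mul]
  · intro x _ hx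
    rw [if_neg hx, mul_zero]
  · intro h
    exact absurd (Finset.mem_univ _) h

/-- `G(d,1,n)`: the group of monomial `n × n` matrices whose nonzero entries are
`d`-th roots of unity. -/
def G (d n : ℕ) : Subgroup (GL (Fin n) ℂ) where
  carrier := {g | ∃ (σ : Equiv.Perm (Fin n)) (a : Fin n → ℂˣ),
    (∀ i, a i ^ d = 1) ∧ (g : Matrix (Fin n) (Fin n) ℂ) = monomialMatrix σ a}
  one_mem' := ⟨1, 1, by simp, by simp [monomialMatrix_one]⟩
  mul_mem' := by
    rintro g h ⟨σ, a, ha, hg⟩ ⟨τ, b, hb, hh⟩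
    refine ⟨σ * τ, fun j => a (τ j) * b j, fun i => by simp [mul_pow, ha, hb], ?_⟩
    rw [Units.val_mul, hg, hh, monomialMatrix_mul]
  inv_mem' := by
    rintro g ⟨σ, a, ha, hg⟩
    refine ⟨σ⁻¹, fun j => (a (σ⁻¹ j))⁻¹, fun i => by simp [ha], ?_⟩
    have h : (g : Matrix (Fin n) (Fin n) ℂ) *
        monomialMatrix σ⁻¹ (fun j => (a (σ⁻¹ j))⁻¹) = 1 := by
      rw [hg, monomialMatrix_mul, ← monomialMatrix_one]
      congr 1
      · simp
      · funext j; simp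
    exact Units.inv_eq_of_mul_eq_one_right h

theorem G_finite (d n : ℕ) (hd : 0 < d) : Finite (G d n) := by
  have : NeZero d := ⟨hd.ne'⟩
  let f : Equiv.Perm (Fin n) × (Fin n → rootsOfUnity d ℂ) → Matrix (Fin n) (Fin n) ℂ :=
    fun p => monomialMatrix p.1 fun j => (p.2 j : ℂˣ)
  have hr : (Set.range f).Finite := Set.finite_range f
  have : Finite (Set.range f) := hr
  refine Finite.of_injective
    (fun w : G d n => (⟨toMatrix w, by
      obtain ⟨σ, a, ha, hg⟩ := w.2
      exact ⟨(σ, fun j => ⟨a j, (mem_rootsOfUnity d _).2 (ha j)⟩), hg.symm⟩⟩ : Set.range f)) ?_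
  intro w w' h
  exact Subtype.ext (Units.ext (congrArg Subtype.val h))

/-- `G(d,1,k)` inside `G(d,1,n)` (`k ≤ n`): the elements acting on the first `k` coordinates,
i.e. fixing the basis vectors `y_{k+1}, …, y_n`. -/
def subG (d n k : ℕ) : Set (G d n) :=
  {w | ∀ j : Fin n, k ≤ (j : ℕ) → (toMatrix w).mulVec (Pi.single j 1) = Pi.single j 1}

/-- The Euler element `eu_{c,k} = ∑_{s ∈ Ref(G(d,1,k))} c_s det(s) s` of `G(d,1,k)`,
in the group algebra of `G(d,1,n)`. -/
def euler {d n : ℕ} (c : Ref (G d n) → ℂ) (k : ℕ) : MonoidAlgebra ℂ (G d n) :=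
  ∑ᶠ (s : Ref (G d n)) (_ : (s : G d n) ∈ subG d n k),
    MonoidAlgebra.single (s : G d n) (c s * (toMatrix s.1).det)

/-- The Jucys–Murphy element `eu_{c,k+1} - eu_{c,k}`; the index `k : Fin n` starts at `0`. -/
def jucysMurphy {d n : ℕ} (c : Ref (G d n) → ℂ) (k : Fin n) : MonoidAlgebra ℂ (G d n) :=
  euler c ((k : ℕ) + 1) - euler c (k : ℕ)

/-- `JM_c(d,n)`, the subalgebra of `ℂG(d,1,n)` generated by the Jucys–Murphy elements. -/
def jmAlgebra {d n : ℕ} (c : Ref (G d n) → ℂ) : Subalgebra ℂ (MonoidAlgebra ℂ (G d n)) :=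
  Algebra.adjoin ℂ (Set.range (jucysMurphy c))

end CalogeroMoser

end

open scoped TensorProduct

noncomputable section

namespace CalogeroMoser

open Polynomial

/-! ### Characteristic polynomials and composition series -/

/-! The Jucys–Murphy algebra is a degeneration of the Gaudin algebra. Give `x_i` a weight that
strictly increases with `i`, and let `O` be the valuation ring of the weighted degree on `ℂ(V)`. A
linear form is then dominated by its last nonzero coordinate, so the coefficient of `s` in `x_k
𝒟_{y_k}` reduces to `c_s det(s)` when `k` is the last coordinate of `α_s`, and to `0` otherwise. The
reflections with last coordinate `k` are those of `G(d,1,k)` not in `G(d,1,k-1)`, so `x_k 𝒟_{y_k}`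
reduces to `J_k` (`isReduction_gaudinOperator`). Hence every element of the Jucys–Murphy algebra
lifts to an element of the Gaudin algebra over `ℂ(V)` with coefficients in `O`.

Characters are compared through characteristic polynomials. The Jucys–Murphy algebra is commutative,
so some element `a` acts by `1` on a given simple module `L` and by `0` on the other composition
factors of the `V_χ`; then `[V_χ : L]` is the multiplicity of the root `1` in the characteristic
polynomial of `a` (`exists_mult_eq_rootMultiplicity`). Lift `a` to `z`. Over `ℂ(V)` the
characteristic polynomial of `z` is a product over the Gaudin composition factors `S`; since `O` is
integrally closed, each factor has coefficients in `O` and can be reduced. The multiplicity `D_S` of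
the root `1` in the reduced factor depends on `S` but not on `χ`
(`exists_rootMultiplicity_map_eq_sum_mult`), whence `γ_L = ∑ D_S γ_S`. -/

theorem charpoly_eq_charpoly_restrict_mul_charpoly_mapQ {k V : Type*} [Field k] [Infinite k]
    [AddCommGroup V] [Module k V] [Module.Finite k V] (f : V →ₗ[k] V) (p : Submodule k V)
    (hp : p ≤ p.comap f) :
    f.charpoly = (f.restrict hp).charpoly * (p.mapQ p f hp).charpoly := by
  -- Over an infinite field it suffices to compare values at each `t`, where the claim is
  -- multiplicativity of `det (t - f)` along the stable subspace.
  refine Polynomial.funext fun t => ?_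
  have ht : p ≤ p.comap (algebraMap k (Module.End k V) t - f) := fun x hx =>
    p.sub_mem (p.smul_mem t hx) (hp hx)
  rw [Polynomial.eval_mul, LinearMap.eval_charpoly, LinearMap.eval_charpoly,
    LinearMap.eval_charpoly, LinearMap.det_eq_det_mul_det p _ ht]
  congr 2
  ext x
  rfl

/-- The characteristic polynomial over `k` of the action of `f : R` on the `R`-module `Y`. -/
def actionCharpoly (k : Type*) {R : Type*} [Field k] [Ring R] [Algebra k R] (f : R)
    (Y : Type*) [AddCommGroup Y] [Module k Y] [Module R Y] [IsScalarTower k R Y]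
    [Module.Finite k Y] : k[X] :=
  (Algebra.lsmul k k Y f).charpoly

section Series

variable {k R X : Type*} [Field k] [Ring R] [Algebra k R] [AddCommGroup X] [Module k X]
  [Module R X] [IsScalarTower k R X] [Module.Finite k X]

theorem actionCharpoly_monic (f : R) : (actionCharpoly k f X).Monic :=
  LinearMap.charpoly_monic _

theorem actionCharpoly_congr {Y : Type*} [AddCommGroup Y] [Module k Y] [Module R Y]
    [IsScalarTower k R Y] [Module.Finite k Y] (e : X ≃ₗ[R] Y) (f : R) :
    actionCharpoly k f X = actionCharpoly k f Y := by
  have := LinearEquiv.charpoly_conj (e.restrictScalars k) (Algebra.lsmul k k X f)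
  rw [actionCharpoly, ← this, actionCharpoly]
  congr 1
  ext y
  simp

instance finite_submodule (M : Submodule R X) : Module.Finite k M :=
  inferInstanceAs (Module.Finite k (M.restrictScalars k))

instance finite_quotient (M : Submodule R X) : Module.Finite k (X ⧸ M) :=
  Module.Finite.of_surjective (M.mkQ.restrictScalars k) M.mkQ_surjective

theorem actionCharpoly_eq_mul_of_submodule [Infinite k] (N : Submodule R X) (f : R) :
    actionCharpoly k f X = actionCharpoly k f N * actionCharpoly k f (X ⧸ N) :=
  charpoly_eq_charpoly_restrict_mul_charpoly_mapQ (Algebra.lsmul k k X f)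
    (N.restrictScalars k) (fun _ hx => N.smul_mem f hx)

theorem actionCharpoly_eq_mul_of_le [Infinite k] {N M : Submodule R X} (h : N ≤ M) (f : R) :
    actionCharpoly k f M =
      actionCharpoly k f N * actionCharpoly k f (M ⧸ N.comap M.subtype) := by
  rw [actionCharpoly_eq_mul_of_submodule (N.comap M.subtype) f,
    actionCharpoly_congr (Submodule.comapSubtypeEquivOfLe h)]

/-- The successive quotients of a series of submodules. -/
abbrev seriesFactor (s : CompositionSeries (Submodule R X)) (i : Fin s.length) : Type _ :=
  s i.succ ⧸ (s i.castSucc).comap (s i.succ).subtype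

instance isScalarTower_seriesFactor (s : CompositionSeries (Submodule R X)) (i : Fin s.length) :
    IsScalarTower k R (seriesFactor s i) :=
  inferInstance

instance finite_seriesFactor (s : CompositionSeries (Submodule R X)) (i : Fin s.length) :
    Module.Finite k (seriesFactor s i) :=
  inferInstance

theorem isSimpleModule_seriesFactor (s : CompositionSeries (Submodule R X)) (i : Fin s.length) :
    IsSimpleModule R (seriesFactor s i) :=
  covBy_iff_quot_is_simple (s.step i).le |>.1 (s.step i)

theorem actionCharpoly_eq_prod [Infinite k] (s : CompositionSeries (Submodule R X))
    (hb : s.head = ⊥) (ht : s.last = ⊤) (f : R) :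
    actionCharpoly k f X = ∏ i, actionCharpoly k f (seriesFactor s i) := by
  have key : ∀ j : Fin (s.length + 1), actionCharpoly k f (s j) =
      ∏ i : Fin s.length, if i.castSucc < j then actionCharpoly k f (seriesFactor s i) else 1 := by
    intro j
    induction j using Fin.induction with
    | zero =>
      have : Subsingleton (s 0) := by
        rw [show s 0 = ⊥ from hb]; infer_instance
      simp only [Fin.not_lt_zero, if_false, Finset.prod_const_one]
      rw [actionCharpoly]
      refine (LinearMap.charpoly_monic _).natDegree_eq_zero.1 ?_
      rw [LinearMap.charpoly_natDegree]
      exact Module.finrank_zero_of_subsingleton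
    | succ j ih =>
      rw [actionCharpoly_eq_mul_of_le (s.step j).le f, ih]
      -- Passing from `j` to its successor switches on only the factor of index `j`, so that factor
      -- is isolated on both sides.
      rw [← Finset.mul_prod_erase _ _ (Finset.mem_univ j),
        ← Finset.mul_prod_erase (Finset.univ : Finset (Fin s.length)) _ (Finset.mem_univ j),
        if_neg (lt_irrefl _), if_pos (Fin.castSucc_lt_succ), one_mul, mul_comm]
      congr 1
      refine Finset.prod_congr rfl fun i hi => if_congr ?_ rfl rfl
      have : i ≠ j := Finset.ne_of_mem_erase hi
      simp only [Fin.lt_def, Fin.val_castSucc, Fin.val_succ]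
      have : (i : ℕ) ≠ j := fun h => this (Fin.ext h)
      omega
  have hl := key (Fin.last _)
  have e : s (Fin.last _) ≃ₗ[R] X :=
    (LinearEquiv.ofEq _ _ (show s (Fin.last _) = ⊤ from ht)).trans Submodule.topEquiv
  rw [← actionCharpoly_congr e f, hl]
  simp [Fin.castSucc_lt_last]

theorem exists_compositionSeries (k : Type*) {R X : Type*} [Field k] [Ring R] [Algebra k R]
    [AddCommGroup X] [Module k X] [Module R X] [IsScalarTower k R X] [Module.Finite k X] :
    ∃ s : CompositionSeries (Submodule R X), s.head = ⊥ ∧ s.last = ⊤ := by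
  have : IsNoetherian R X := isNoetherian_of_tower k inferInstance
  have : IsArtinian R X := isArtinian_of_tower k inferInstance
  exact exists_compositionSeries_of_isNoetherian_isArtinian R X

end Series

/-! ### Separating the simple modules of a commutative algebra -/

/-- A simple module over a commutative ring is the quotient by its annihilator, a maximal ideal, and
nested maximal ideals coincide. -/
theorem nonempty_linearEquiv_of_annihilator_le {R S T : Type*} [CommRing R] [AddCommGroup S]
    [Module R S] [AddCommGroup T] [Module R T] [IsSimpleModule R S] [IsSimpleModule R T]
    (h : Module.annihilator R S ≤ Module.annihilator R T) : Nonempty (S ≃ₗ[R] T) := by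
  obtain ⟨I, hI, ⟨e⟩⟩ := isSimpleModule_iff_quot_maximal.1 ‹IsSimpleModule R S›
  obtain ⟨J, hJ, ⟨e'⟩⟩ := isSimpleModule_iff_quot_maximal.1 ‹IsSimpleModule R T›
  rw [e.annihilator_eq, e'.annihilator_eq, Ideal.annihilator_quotient,
    Ideal.annihilator_quotient] at h
  obtain rfl := hI.eq_of_le hJ.ne_top h
  exact ⟨e.trans e'.symm⟩

theorem isMaximal_annihilator {R S : Type*} [CommRing R] [AddCommGroup S] [Module R S]
    [IsSimpleModule R S] : (Module.annihilator R S).IsMaximal := by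
  obtain ⟨I, hI, ⟨e⟩⟩ := isSimpleModule_iff_quot_maximal.1 ‹IsSimpleModule R S›
  rwa [e.annihilator_eq, Ideal.annihilator_quotient]

open Classical in
-- The maximal ideal of `S i₀` is prime, so it does not contain the intersection of the finitely
-- many other annihilators. An element `g` of that intersection, rescaled to be `1` modulo the ideal
-- of `S i₀`, acts by `1` on copies of `S i₀` and by `0` elsewhere. As `k` is algebraically closed
-- the simple modules are lines, so the root `1` is simple in the first case.
theorem exists_rootMultiplicity_eq_ite {k R ι : Type*} [Field k] [IsAlgClosed k] [Ring R]
    [Algebra k R] (hR : ∀ a b : R, a * b = b * a) [Finite ι] (S : ι → Type*)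
    [∀ i, AddCommGroup (S i)] [∀ i, Module k (S i)] [∀ i, Module R (S i)]
    [∀ i, IsScalarTower k R (S i)] [∀ i, Module.Finite k (S i)] [∀ i, IsSimpleModule R (S i)]
    (i₀ : ι) :
    ∃ f : R, ∀ i, (actionCharpoly k f (S i)).rootMultiplicity 1 =
      if Nonempty (S i ≃ₗ[R] S i₀) then 1 else 0 := by
  have := Fintype.ofFinite ι
  let _ : CommRing R := { ‹Ring R› with mul_comm := hR }
  have : IsMulCommutative R := ⟨⟨hR⟩⟩
  let m : ι → Ideal R := fun i => Module.annihilator R (S i)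
  have hm : ∀ i, (m i).IsMaximal := fun i => isMaximal_annihilator
  let T : Finset ι := {i | ¬ Nonempty (S i ≃ₗ[R] S i₀)}
  have hle : ¬ T.inf m ≤ m i₀ := by
    rw [(hm i₀).isPrime.inf_le']
    rintro ⟨i, hi, h⟩
    exact (Finset.mem_filter.1 hi).2 (nonempty_linearEquiv_of_annihilator_le h)
  obtain ⟨g, hg, hg'⟩ := SetLike.not_le_iff_exists.1 hle
  obtain ⟨h, hh⟩ := (hm i₀).exists_inv hg'
  obtain ⟨j, hj, hh⟩ := hh
  refine ⟨h * g, fun i => ?_⟩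
  have hnt : Nontrivial (S i) := IsSimpleModule.nontrivial R (S i)
  split_ifs with he
  · obtain ⟨e⟩ := he
    have h1 : Algebra.lsmul k k (S i) (h * g) = 1 := by
      ext x
      have hz : j • x = 0 := by
        have := e.annihilator_eq
        exact Module.mem_annihilator.1 (this ▸ hj : j ∈ Module.annihilator R (S i)) x
      have : (h * g) • x + j • x = x := by rw [← add_smul, hh, one_smul]
      rw [hz, add_zero] at this
      exact this
    rw [actionCharpoly, h1, LinearMap.charpoly_one,
      IsSimpleModule.finrank_eq_one_of_isMulCommutative R (S i) k, pow_one]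
    simpa using rootMultiplicity_X_sub_C_self (R := k) (x := 1)
  · have h0 : Algebra.lsmul k k (S i) (h * g) = 0 := by
      ext x
      have : g ∈ m i := Finset.inf_le (f := m) (Finset.mem_filter.2 ⟨Finset.mem_univ i, he⟩) hg
      exact Module.mem_annihilator.1 ((m i).mul_mem_left h this) x
    rw [actionCharpoly, h0, LinearMap.charpoly_zero]
    refine rootMultiplicity_eq_zero ?_
    simp [IsRoot]

/-! ### Matrices of group algebra elements over a `ℂ`-algebra -/

section RepMatrix

variable {W : Type*} [Group W] {m : ℕ} (ρ : Representation ℂ W (Fin m → ℂ))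

/-- The action of `S[W]` on `Sᵐ` deduced from a complex matrix representation of `W`. -/
def repMatrix (S : Type*) [CommRing S] [Algebra ℂ S] :
    MonoidAlgebra S W →ₐ[S] Matrix (Fin m) (Fin m) S :=
  MonoidAlgebra.lift S _ W
    ((RingHom.toMonoidHom (algebraMap ℂ S).mapMatrix).comp
      ((LinearMap.toMatrixAlgEquiv' : _ ≃ₐ[ℂ] Matrix (Fin m) (Fin m) ℂ).toMulEquiv.toMonoidHom.comp
        ρ))

theorem repMatrix_single (S : Type*) [CommRing S] [Algebra ℂ S] (w : W) (a : S) :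
    repMatrix ρ S (MonoidAlgebra.single w a) =
      a • (LinearMap.toMatrix' (ρ w)).map (algebraMap ℂ S) :=
  MonoidAlgebra.lift_single ..

theorem map_repMatrix {S T : Type*} [CommRing S] [Algebra ℂ S] [CommRing T] [Algebra ℂ T]
    (φ : S →ₐ[ℂ] T) (z : MonoidAlgebra S W) :
    (repMatrix ρ S z).map φ = repMatrix ρ T (MonoidAlgebra.mapRingHom W (φ : S →+* T) z) := by
  induction z using MonoidAlgebra.induction with
  | zero => simp
  | single_add w a f _ _ ih =>
    rw [map_add, Matrix.map_add φ (map_add φ), ih, map_add, map_add, MonoidAlgebra.mapRingHom_single,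
      repMatrix_single, repMatrix_single]
    congr 1
    ext i j
    simp

theorem charpoly_map_repMatrix {S T : Type*} [CommRing S] [Algebra ℂ S] [CommRing T]
    [Algebra ℂ T] (φ : S →ₐ[ℂ] T) (z : MonoidAlgebra S W) :
    (repMatrix ρ S z).charpoly.map (φ : S →+* T) =
      (repMatrix ρ T (MonoidAlgebra.mapRingHom W (φ : S →+* T) z)).charpoly := by
  rw [← map_repMatrix, ← Matrix.charpoly_map]
  rfl

theorem toMatrix_asAlgebraHom_extendScalars (K : Type*) [Field K] [Algebra ℂ K]
    (z : MonoidAlgebra K W) :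
    LinearMap.toMatrix (Algebra.TensorProduct.basis K (Pi.basisFun ℂ (Fin m)))
      (Algebra.TensorProduct.basis K (Pi.basisFun ℂ (Fin m)))
      ((extendScalars K ρ).asAlgebraHom z) = repMatrix ρ K z := by
  induction z using MonoidAlgebra.induction with
  | zero => simp
  | single_add w a f _ _ ih =>
    have h : extendScalars K ρ w = (ρ w).baseChange K := rfl
    rw [map_add, map_add, ih, map_add, Representation.asAlgebraHom_single, repMatrix_single,
      map_smul, h, LinearMap.toMatrix_baseChange, LinearMap.toMatrix_eq_toMatrix']

/-- Expressing the polynomial by a matrix makes it compatible with change of coefficient ring: it is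
integral when `z` is, and reduces with `z`. -/
theorem actionCharpoly_extendScalars (K : Type*) [Field K] [Algebra ℂ K]
    (B : Subalgebra K (MonoidAlgebra K W)) (z : B) :
    actionCharpoly K z (extendScalars K ρ).asModule = (repMatrix ρ K (z : MonoidAlgebra K W)).charpoly := by
  rw [← toMatrix_asAlgebraHom_extendScalars, LinearMap.charpoly_toMatrix]
  rfl

end RepMatrix

/-! ### Decomposition of cellular characters under specialization -/

theorem rootMultiplicity_prod {R ι : Type*} [CommRing R] [IsDomain R] (s : Finset ι) (f : ι → R[X])
    (hf : ∀ i ∈ s, f i ≠ 0) (x : R) :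
    (∏ i ∈ s, f i).rootMultiplicity x = ∑ i ∈ s, (f i).rootMultiplicity x := by
  classical
  rw [← count_roots, roots_prod f s (Finset.prod_ne_zero_iff.2 hf), Multiset.count_bind]
  simp only [count_roots]
  rfl

open Classical in
theorem mult_eq_sum {B X L : Type*} [Ring B] [AddCommGroup X] [Module B X]
    [AddCommGroup L] [Module B L] (s : CompositionSeries (Submodule B X))
    (hb : s.head = ⊥) (ht : s.last = ⊤) :
    mult B X L = ∑ i, if Nonempty (seriesFactor s i ≃ₗ[B] L) then 1 else 0 := by
  rw [mult_eq s hb ht, factorCount, Nat.card_eq_fintype_card, Fintype.card_subtype,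
    Finset.card_filter]

section Specialization

variable {I RA RB O K κ : Type} [Finite I] [Ring RA] [Algebra ℂ RA] [Field K]
  [Ring RB] [Algebra K RB] [CommRing O] [IsIntegrallyClosed O] [Algebra O K]
  [IsFractionRing O K] [Field κ]
  (X Y : I → Type) [∀ χ, AddCommGroup (X χ)] [∀ χ, Module ℂ (X χ)] [∀ χ, Module RA (X χ)]
  [∀ χ, IsScalarTower ℂ RA (X χ)] [∀ χ, Module.Finite ℂ (X χ)]
  [∀ χ, AddCommGroup (Y χ)] [∀ χ, Module K (Y χ)] [∀ χ, Module RB (Y χ)]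
  [∀ χ, IsScalarTower K RB (Y χ)] [∀ χ, Module.Finite K (Y χ)]

open Classical in
/-- For a simple module `L` over a commutative algebra, some element `a` detects the multiplicity
of `L` in each of finitely many modules through its characteristic polynomial. -/
theorem exists_mult_eq_rootMultiplicity (hA : ∀ a b : RA, a * b = b * a)
    (L : Type) [AddCommGroup L] [Module RA L] :
    (∀ χ, mult RA (X χ) L = 0) ∨
      ∃ a : RA, ∀ χ, mult RA (X χ) L = (actionCharpoly ℂ a (X χ)).rootMultiplicity 1 := by
  choose s hsb hst using fun χ : I => exists_compositionSeries ℂ (R := RA) (X := X χ)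
  by_cases hex : ∃ p : Σ χ, Fin (s χ).length, Nonempty (seriesFactor (s p.1) p.2 ≃ₗ[RA] L)
  swap
  · left
    intro χ
    rw [mult_eq_sum (s χ) (hsb χ) (hst χ), Finset.sum_eq_zero]
    exact fun i _ => if_neg fun h => hex ⟨⟨χ, i⟩, h⟩
  right
  obtain ⟨p₀, ⟨e₀⟩⟩ := hex
  have hsimp : ∀ p : Σ χ, Fin (s χ).length, IsSimpleModule RA (seriesFactor (s p.1) p.2) :=
    fun p => isSimpleModule_seriesFactor (s p.1) p.2
  -- `L` carries no given `ℂ`-structure, so the composition factor `p₀` isomorphic to it stands in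
  -- for it.
  obtain ⟨f, hf⟩ := exists_rootMultiplicity_eq_ite (k := ℂ) hA
    (fun p : Σ χ, Fin (s χ).length => seriesFactor (s p.1) p.2) p₀
  refine ⟨f, fun χ => ?_⟩
  rw [actionCharpoly_eq_prod (s χ) (hsb χ) (hst χ),
    rootMultiplicity_prod _ _ fun i _ => (actionCharpoly_monic f).ne_zero,
    mult_eq_sum (s χ) (hsb χ) (hst χ)]
  refine Finset.sum_congr rfl fun i _ => ?_
  rw [hf ⟨χ, i⟩]
  exact if_congr ⟨fun ⟨e⟩ => ⟨e.trans e₀.symm⟩, fun ⟨e⟩ => ⟨e.trans e₀⟩⟩ rfl rfl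

open Classical in
/-- If the characteristic polynomials of the action of `b` on finitely many modules have
coefficients in an integrally closed domain `O`, then the multiplicity of a root of their
reductions is a fixed combination of multiplicities of simple modules. -/
theorem exists_rootMultiplicity_map_eq_sum_mult [Infinite K] (π : O →+* κ) (b : RB)
    (P : I → O[X])
    (hP : ∀ χ, (P χ).map (algebraMap O K) = actionCharpoly K b (Y χ)) (x : κ) :
    ∃ (Q : Type) (_ : Fintype Q) (D : Q → ℕ) (S : Q → Type) (_ : ∀ c, AddCommGroup (S c))
      (_ : ∀ c, Module RB (S c)), (∀ c, IsSimpleModule RB (S c)) ∧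
        ∀ χ, ((P χ).map π).rootMultiplicity x = ∑ c, D c * mult RB (Y χ) (S c) := by
  have := Fintype.ofFinite I
  choose t htb htt using fun χ : I => exists_compositionSeries K (R := RB) (X := Y χ)
  have hPK : ∀ χ, (P χ).map (algebraMap O K) =
      ∏ i, actionCharpoly K b (seriesFactor (t χ) i) := fun χ => by
    rw [hP, ← actionCharpoly_eq_prod (t χ) (htb χ) (htt χ)]
  have hPm : ∀ χ, (P χ).Monic := fun χ =>
    monic_of_injective (IsFractionRing.injective O K) (hP χ ▸ actionCharpoly_monic b)
  -- Gauss's lemma: a monic divisor over `K` of a monic polynomial over the integrally closed `O`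
  -- has coefficients in `O`.
  have hq : ∀ p : Σ χ, Fin (t χ).length, ∃ q : O[X],
      q.map (algebraMap O K) = actionCharpoly K b (seriesFactor (t p.1) p.2) := by
    intro p
    have hdvd : actionCharpoly K b (seriesFactor (t p.1) p.2) ∣ (P p.1).map (algebraMap O K) :=
      (hPK p.1).symm ▸ Finset.dvd_prod_of_mem _ (Finset.mem_univ p.2)
    obtain ⟨q, hq⟩ := IsIntegrallyClosed.eq_map_mul_C_of_dvd K (hPm p.1) hdvd
    refine ⟨q, ?_⟩
    rwa [(actionCharpoly_monic b).leadingCoeff, C_1, mul_one] at hq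
  choose q hq using hq
  have hinj : Function.Injective (Polynomial.map (algebraMap O K)) :=
    map_injective _ (IsFractionRing.injective O K)
  have hqm : ∀ p, (q p).Monic := fun p =>
    monic_of_injective (IsFractionRing.injective O K) (hq p ▸ actionCharpoly_monic b)
  have hPq : ∀ χ, P χ = ∏ i, q ⟨χ, i⟩ := by
    intro χ
    refine hinj ?_
    rw [hPK, Polynomial.map_prod]
    exact Finset.prod_congr rfl fun i _ => (hq ⟨χ, i⟩).symm
  let r : Setoid (Σ χ, Fin (t χ).length) :=
    { r := fun p p' => Nonempty (seriesFactor (t p.1) p.2 ≃ₗ[RB] seriesFactor (t p'.1) p'.2)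
      iseqv := ⟨fun _ => ⟨.refl _ _⟩, fun ⟨e⟩ => ⟨e.symm⟩, fun ⟨e⟩ ⟨e'⟩ => ⟨e.trans e'⟩⟩ }
  let D : (Σ χ, Fin (t χ).length) → ℕ := fun p => ((q p).map π).rootMultiplicity x
  -- Isomorphic factors have equal characteristic polynomials, so `D` depends only on the
  -- isomorphism class, whichever `χ` the factor comes from.
  have hD : ∀ p p' : Σ χ, Fin (t χ).length, r p p' → D p = D p' := by
    rintro p p' ⟨e⟩
    have : q p = q p' := hinj (by rw [hq, hq, actionCharpoly_congr e])
    simp only [D, this]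
  refine ⟨Quotient r, inferInstance, fun c => D c.out,
    fun c => seriesFactor (t c.out.1) c.out.2, inferInstance, inferInstance,
    fun c => isSimpleModule_seriesFactor _ _, fun χ => ?_⟩
  rw [hPq, Polynomial.map_prod,
    rootMultiplicity_prod _ _ fun i _ => ((hqm ⟨χ, i⟩).map _).ne_zero]
  simp_rw [mult_eq_sum (t χ) (htb χ) (htt χ), Finset.mul_sum, mul_ite, mul_one, mul_zero]
  rw [Finset.sum_comm]
  refine Finset.sum_congr rfl fun i _ => ?_
  rw [Finset.sum_eq_single (⟦⟨χ, i⟩⟧ : Quotient r)]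
  · have hout : r ⟨χ, i⟩ (⟦⟨χ, i⟩⟧ : Quotient r).out := r.symm (Quotient.mk_out _)
    exact (hD _ _ hout).trans (if_pos hout).symm
  · intro c _ hc
    refine if_neg fun h => hc ?_
    rw [← Quotient.out_eq c]
    exact (Quotient.sound (show r ⟨χ, i⟩ c.out from h)).symm
  · exact fun h => absurd (Finset.mem_univ _) h

end Specialization

/-- If every element of a commutative subalgebra `A` of `ℂW` is the reduction of an element
of `O[W] ∩ B`, where `O` is an integrally closed domain with fraction field `K` and `B ⊆ K[W]`,
then the cellular characters for `A` are sums of cellular characters for `B`. -/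
theorem IsCellularCharacter.exists_multiset_of_specialization {W : Type} [Group W] [Finite W]
    {O K κ : Type} [CommRing O] [IsIntegrallyClosed O] [Field K] [Algebra O K]
    [IsFractionRing O K] [Field κ] [Algebra ℂ O] [Algebra ℂ K] [IsScalarTower ℂ O K]
    [Algebra ℂ κ] (π : O →ₐ[ℂ] κ) (A : Subalgebra ℂ (MonoidAlgebra ℂ W))
    (hA : ∀ a b : A, a * b = b * a) (B : Subalgebra K (MonoidAlgebra K W))
    (hlift : ∀ a ∈ A, ∃ z : MonoidAlgebra O W,
      MonoidAlgebra.mapRingHom W (algebraMap O K) z ∈ B ∧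
        MonoidAlgebra.mapRingHom W (π : O →+* κ) z =
          MonoidAlgebra.mapRingHom W (algebraMap ℂ κ) a)
    {γ : W → ℂ} (hγ : IsCellularCharacter A γ) :
    ∃ m : Multiset (W → ℂ), (∀ ψ ∈ m, IsCellularCharacter B ψ) ∧ γ = m.sum := by
  obtain ⟨L, _, _, hL, rfl⟩ := hγ
  have : Fintype (Irr W) := Fintype.ofFinite _
  -- Gives the infinitude of `K` required for factoring characteristic polynomials.
  have : CharZero K := charZero_of_injective_algebraMap (algebraMap ℂ K).injective
  obtain h0 | ⟨f, hf⟩ := exists_mult_eq_rootMultiplicity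
    (fun χ : Irr W => (extendScalars ℂ (irrRep χ)).asModule) hA L
  · refine ⟨0, by simp, ?_⟩
    rw [Multiset.sum_zero, cellularCharacter, finsum_eq_zero_of_forall_eq_zero]
    intro χ
    rw [h0 χ, zero_smul]
  obtain ⟨z, hzB, hz⟩ := hlift f f.2
  let zB : B := ⟨_, hzB⟩
  let P : Irr W → O[X] := fun χ => (repMatrix (irrRep χ) O z).charpoly
  have hP : ∀ χ, (P χ).map (algebraMap O K) =
      actionCharpoly K zB (extendScalars K (irrRep χ)).asModule := by
    intro χ
    rw [actionCharpoly_extendScalars]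
    exact charpoly_map_repMatrix (irrRep χ) (IsScalarTower.toAlgHom ℂ O K) z
  have hPκ : ∀ χ, (P χ).map (π : O →+* κ) =
      (actionCharpoly ℂ f (extendScalars ℂ (irrRep χ)).asModule).map (algebraMap ℂ κ) := by
    intro χ
    rw [actionCharpoly_extendScalars, charpoly_map_repMatrix, hz]
    exact (charpoly_map_repMatrix (irrRep χ) (Algebra.ofId ℂ κ) _).symm
  obtain ⟨Q, _, D, S, _, _, hS, hD⟩ := exists_rootMultiplicity_map_eq_sum_mult
    (fun χ : Irr W => (extendScalars K (irrRep χ)).asModule) (π : O →+* κ) zB P hP 1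
  have hmult : ∀ χ : Irr W, mult A (extendScalars ℂ (irrRep χ)).asModule L =
      ∑ c, D c * mult B (extendScalars K (irrRep χ)).asModule (S c) := by
    intro χ
    rw [← hD χ, hPκ, ← map_one (algebraMap ℂ κ),
      ← eq_rootMultiplicity_map (algebraMap ℂ κ).injective, hf χ]
  refine ⟨∑ c, Multiset.replicate (D c) (cellularCharacter B (S c)), ?_, ?_⟩
  · intro ψ hψ
    obtain ⟨c, -, hc⟩ := Multiset.mem_sum.1 hψ
    rw [Multiset.eq_of_mem_replicate hc]
    exact ⟨_, inferInstance, inferInstance, hS c, rfl⟩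
  · rw [← Multiset.coe_sumAddMonoidHom, map_sum]
    simp only [Multiset.coe_sumAddMonoidHom, Multiset.sum_replicate, cellularCharacter,
      finsum_eq_sum_of_fintype, Finset.smul_sum, smul_smul]
    rw [Finset.sum_comm]
    refine Finset.sum_congr rfl fun χ _ => ?_
    rw [hmult, Finset.sum_smul]

open WithZero

/-! ### A valuation on `ℂ(V)` -/

/-- The homomorphism `xᵢ ↦ xᵢ T^(i+1)`. -/
def scalingHom (n : ℕ) : PolyV n →+* Polynomial (RatV n) :=
  MvPolynomial.eval₂Hom (Polynomial.C.comp (algebraMap ℂ (RatV n))) fun i =>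
    Polynomial.C (algebraMap (PolyV n) (RatV n) (MvPolynomial.X i)) * Polynomial.X ^ ((i : ℕ) + 1)

/-- Setting `T = 1` recovers the inclusion of `ℂ[V]` in `ℂ(V)`. -/
theorem scalingHom_injective (n : ℕ) : Function.Injective (scalingHom n) := by
  have h : (Polynomial.evalRingHom 1).comp (scalingHom n) = algebraMap (PolyV n) (RatV n) := by
    refine MvPolynomial.ringHom_ext (fun c => ?_) fun i => ?_
    · simpa [scalingHom] using IsScalarTower.algebraMap_apply ℂ (PolyV n) (RatV n) c
    · simp [scalingHom]
  refine Function.Injective.of_comp (f := Polynomial.evalRingHom (1 : RatV n)) ?_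
  rw [← RingHom.coe_comp, h]
  exact IsFractionRing.injective _ _

theorem algebraMap_scalingHom_injective (n : ℕ) : Function.Injective
    ((algebraMap (Polynomial (RatV n)) (RatFunc (RatV n))).comp (scalingHom n)) := by
  rw [RingHom.coe_comp]
  exact (RatFunc.algebraMap_injective _).comp (scalingHom_injective n)

open Classical in
/-- The valuation on `ℂ(V)`, trivial on `ℂ`, given by the weighted degree in which `xᵢ` has
weight `i + 1`. -/
def weightValuation (n : ℕ) : Valuation (RatV n) ℤᵐ⁰ :=
  (RatFunc.inftyValuation (RatV n)).comap
    (IsFractionRing.lift (K := RatV n) (algebraMap_scalingHom_injective n))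

theorem weightValuation_X {n : ℕ} (i : Fin n) :
    weightValuation n (algebraMap (PolyV n) (RatV n) (MvPolynomial.X i)) =
      exp (((i : ℕ) : ℤ) + 1) := by
  classical
  have hX : algebraMap (PolyV n) (RatV n) (MvPolynomial.X i) ≠ 0 := by
    simp
  rw [weightValuation, Valuation.comap_apply, IsFractionRing.lift_algebraMap, RingHom.comp_apply,
    scalingHom, MvPolynomial.coe_eval₂Hom, MvPolynomial.eval₂_X, map_mul, map_mul,
    RatFunc.algebraMap_C, RatFunc.inftyValuation.C _ hX, map_pow, RatFunc.algebraMap_X, map_pow,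
    RatFunc.inftyValuation.X, one_mul, ← exp_nsmul]
  simp

theorem weightValuation_algebraMap {n : ℕ} {c : ℂ} (hc : c ≠ 0) :
    weightValuation n (algebraMap ℂ (RatV n) c) = 1 := by
  classical
  have h : algebraMap ℂ (RatV n) c ≠ 0 := by simpa using hc
  rw [weightValuation, Valuation.comap_apply, IsScalarTower.algebraMap_apply ℂ (PolyV n) (RatV n),
    IsFractionRing.lift_algebraMap, RingHom.comp_apply, scalingHom, MvPolynomial.algebraMap_eq,
    MvPolynomial.coe_eval₂Hom, MvPolynomial.eval₂_C, RingHom.comp_apply, RatFunc.algebraMap_C,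
    RatFunc.inftyValuation.C _ h]

theorem weightValuation_algebraMap_le_one {n : ℕ} (c : ℂ) :
    weightValuation n (algebraMap ℂ (RatV n) c) ≤ 1 := by
  rcases eq_or_ne c 0 with rfl | hc
  · simp
  · exact (weightValuation_algebraMap hc).le

/-- `M` is the last coordinate on which the linear form `a` does not vanish. -/
def IsLastCoord {n : ℕ} (a : Module.Dual ℂ (Fin n → ℂ)) (M : Fin n) : Prop :=
  a (Pi.single M 1) ≠ 0 ∧ ∀ i, M < i → a (Pi.single i 1) = 0

theorem exists_isLastCoord {n : ℕ} {a : Module.Dual ℂ (Fin n → ℂ)} (ha : a ≠ 0) :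
    ∃ M, IsLastCoord a M := by
  classical
  let s : Finset (Fin n) := {i | a (Pi.single i 1) ≠ 0}
  have hs : s.Nonempty := by
    by_contra h
    refine ha ((Pi.basisFun ℂ (Fin n)).ext fun i => ?_)
    by_contra hi
    exact h ⟨i, by simpa [s] using hi⟩
  refine ⟨s.max' hs, (Finset.mem_filter.1 (s.max'_mem hs)).2, fun i hi => ?_⟩
  by_contra h
  exact absurd (s.le_max' i (by simpa [s] using h)) (not_le.2 hi)

/-- Once the term in `x_M` is removed, only variables of smaller weight remain. -/
theorem weightValuation_linearForm_sub_lt {n : ℕ} {a : Module.Dual ℂ (Fin n → ℂ)} {M : Fin n}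
    (hM : IsLastCoord a M) :
    weightValuation n (algebraMap (PolyV n) (RatV n) (linearFormToPoly a) -
      algebraMap ℂ (RatV n) (a (Pi.single M 1)) *
        algebraMap (PolyV n) (RatV n) (MvPolynomial.X M)) < exp (((M : ℕ) : ℤ) + 1) := by
  rw [linearFormToPoly, ← Finset.add_sum_erase _ _ (Finset.mem_univ M), map_add, map_mul,
    ← MvPolynomial.algebraMap_eq, ← IsScalarTower.algebraMap_apply, add_sub_cancel_left, map_sum]
  refine Valuation.map_sum_lt _ exp_ne_zero fun i hi => ?_
  rw [map_mul, ← IsScalarTower.algebraMap_apply, map_mul, weightValuation_X]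
  rcases lt_or_gt_of_ne (Finset.ne_of_mem_erase hi) with h | h
  · refine (mul_le_of_le_one_left' (weightValuation_algebraMap_le_one _)).trans_lt ?_
    rw [exp_lt_exp]
    have : (i : ℕ) < M := h
    omega
  · rw [hM.2 i h, map_zero, map_zero, zero_mul]
    exact exp_pos

theorem weightValuation_linearForm {n : ℕ} {a : Module.Dual ℂ (Fin n → ℂ)} {M : Fin n}
    (hM : IsLastCoord a M) :
    weightValuation n (algebraMap (PolyV n) (RatV n) (linearFormToPoly a)) =
      exp (((M : ℕ) : ℤ) + 1) := by
  have h : weightValuation n (algebraMap ℂ (RatV n) (a (Pi.single M 1)) *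
        algebraMap (PolyV n) (RatV n) (MvPolynomial.X M)) = exp (((M : ℕ) : ℤ) + 1) := by
    rw [map_mul, weightValuation_algebraMap hM.1, weightValuation_X, one_mul]
  rw [← h]
  refine Valuation.map_eq_of_sub_lt _ ?_
  rw [h]
  exact weightValuation_linearForm_sub_lt hM

/-- The coefficient of `x_k 𝒟_{y_k}` at a reflection reduces to `b` or `0`, according to whether
`k` is the last coordinate of the root. -/
theorem weightValuation_coeff_sub_lt_one {n : ℕ} {a : Module.Dual ℂ (Fin n → ℂ)} {M : Fin n}
    (hM : IsLastCoord a M) (b : ℂ) (k : Fin n) :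
    weightValuation n (algebraMap (PolyV n) (RatV n) (MvPolynomial.X k) *
      (algebraMap (PolyV n) (RatV n) (MvPolynomial.C (b * a (Pi.single k 1))) /
        algebraMap (PolyV n) (RatV n) (linearFormToPoly a)) -
      algebraMap ℂ (RatV n) (if k = M then b else 0)) < 1 := by
  have hv := weightValuation_linearForm hM
  have h0 : algebraMap (PolyV n) (RatV n) (linearFormToPoly a) ≠ 0 := by
    intro h
    rw [h, map_zero] at hv
    exact exp_ne_zero hv.symm
  rw [← MvPolynomial.algebraMap_eq, ← IsScalarTower.algebraMap_apply]
  rcases lt_trichotomy k M with h | rfl | h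
  -- For `k < M` the weight of `x_k` is smaller than that of the form in the denominator.
  · rw [if_neg h.ne, map_zero, sub_zero, map_mul, map_div₀, hv, weightValuation_X, mul_div_assoc',
      div_lt_one₀ exp_pos]
    refine (mul_le_of_le_one_right' (weightValuation_algebraMap_le_one _)).trans_lt ?_
    rw [exp_lt_exp]
    have : (k : ℕ) < M := h
    omega
  · have := weightValuation_linearForm_sub_lt hM
    rw [if_pos rfl]
    set ℓ := algebraMap (PolyV n) (RatV n) (linearFormToPoly a)
    -- For `k = M` the error is `-b` times the non-dominant part of the form divided by the form.
    have e : algebraMap (PolyV n) (RatV n) (MvPolynomial.X k) *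
        (algebraMap ℂ (RatV n) (b * a (Pi.single k 1)) / ℓ) - algebraMap ℂ (RatV n) b =
        algebraMap ℂ (RatV n) (-b) * ((ℓ - algebraMap ℂ (RatV n) (a (Pi.single k 1)) *
        algebraMap (PolyV n) (RatV n) (MvPolynomial.X k)) / ℓ) := by
      rw [map_mul, map_neg]
      field_simp
      ring
    rw [e, map_mul]
    refine (mul_le_of_le_one_left' (weightValuation_algebraMap_le_one _)).trans_lt ?_
    rwa [map_div₀, hv, div_lt_one₀ exp_pos]
  · rw [if_neg h.ne', hM.2 k h]
    simp

/-! ### Reduction of group algebra elements -/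

/-- The valuation ring of `weightValuation`. -/
abbrev weightRing (n : ℕ) : ValuationSubring (RatV n) := (weightValuation n).valuationSubring

instance algebraWeightRing (n : ℕ) : Algebra ℂ (weightRing n) :=
  ((algebraMap ℂ (RatV n)).codRestrict (weightRing n)
    weightValuation_algebraMap_le_one).toAlgebra

instance isScalarTowerWeightRing (n : ℕ) : IsScalarTower ℂ (weightRing n) (RatV n) :=
  .of_algebraMap_eq fun _ => rfl

/-- The residue field of the valuation ring of `weightValuation`. -/
abbrev weightResidue (n : ℕ) : Type := IsLocalRing.ResidueField (weightRing n)

/-- `z ∈ ℂ(V)W` has integral coefficients, and reduces to `w ∈ ℂW`. -/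
def IsReduction {n : ℕ} {W : Type*} [Monoid W] (z : MonoidAlgebra (RatV n) W)
    (w : MonoidAlgebra ℂ W) : Prop :=
  ∃ z₀ : MonoidAlgebra (weightRing n) W,
    MonoidAlgebra.mapRingHom W (algebraMap (weightRing n) (RatV n)) z₀ = z ∧
    MonoidAlgebra.mapRingHom W (IsLocalRing.residue (weightRing n)) z₀ =
      MonoidAlgebra.mapRingHom W (algebraMap ℂ (weightResidue n)) w

section Reduction

variable {n : ℕ} {W : Type*} [Monoid W]

theorem IsReduction.add {z z' : MonoidAlgebra (RatV n) W} {w w' : MonoidAlgebra ℂ W}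
    (h : IsReduction z w) (h' : IsReduction z' w') : IsReduction (z + z') (w + w') := by
  obtain ⟨z₀, rfl, h⟩ := h
  obtain ⟨z₁, rfl, h'⟩ := h'
  exact ⟨z₀ + z₁, map_add .., by rw [map_add, map_add, h, h']⟩

theorem IsReduction.mul {z z' : MonoidAlgebra (RatV n) W} {w w' : MonoidAlgebra ℂ W}
    (h : IsReduction z w) (h' : IsReduction z' w') : IsReduction (z * z') (w * w') := by
  obtain ⟨z₀, rfl, h⟩ := h
  obtain ⟨z₁, rfl, h'⟩ := h'
  exact ⟨z₀ * z₁, map_mul .., by rw [map_mul, map_mul, h, h']⟩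

theorem isReduction_zero : IsReduction (0 : MonoidAlgebra (RatV n) W) 0 :=
  ⟨0, map_zero _, by rw [map_zero, map_zero]⟩

theorem IsReduction.sum {ι : Type*} (s : Finset ι) {z : ι → MonoidAlgebra (RatV n) W}
    {w : ι → MonoidAlgebra ℂ W} (h : ∀ i ∈ s, IsReduction (z i) (w i)) :
    IsReduction (∑ i ∈ s, z i) (∑ i ∈ s, w i) := by
  classical
  induction s using Finset.induction_on with
  | empty => exact isReduction_zero
  | insert i s hi ih =>
    rw [Finset.sum_insert hi, Finset.sum_insert hi]
    exact (h i (Finset.mem_insert_self i s)).add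
      (ih fun j hj => h j (Finset.mem_insert_of_mem hj))

theorem isReduction_single (g : W) {a : RatV n} {b : ℂ}
    (h : weightValuation n (a - algebraMap ℂ (RatV n) b) < 1) :
    IsReduction (MonoidAlgebra.single g a) (MonoidAlgebra.single g b) := by
  have ha : a ∈ weightRing n := by
    have := (weightRing n).add_mem _ _ h.le (weightValuation_algebraMap_le_one b)
    rwa [sub_add_cancel] at this
  refine ⟨MonoidAlgebra.single g ⟨a, ha⟩, MonoidAlgebra.mapRingHom_single .., ?_⟩
  rw [MonoidAlgebra.mapRingHom_single, MonoidAlgebra.mapRingHom_single]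
  congr 1
  rw [IsScalarTower.algebraMap_apply ℂ (weightRing n) (weightResidue n)]
  refine sub_eq_zero.1 ?_
  rw [IsLocalRing.ResidueField.algebraMap_eq, ← map_sub, IsLocalRing.residue_eq_zero_iff]
  exact (Valuation.mem_maximalIdeal_iff _ _).2 h

theorem isReduction_algebraMap (b : ℂ) :
    IsReduction (algebraMap (RatV n) (MonoidAlgebra (RatV n) W) (algebraMap ℂ (RatV n) b))
      (algebraMap ℂ (MonoidAlgebra ℂ W) b) :=
  isReduction_single 1 (by simp)

/-- Elements that lift to `B` form a subalgebra, so lifting generators is enough. -/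
theorem exists_mem_isReduction_of_adjoin {s : Set (MonoidAlgebra ℂ W)}
    (B : Subalgebra (RatV n) (MonoidAlgebra (RatV n) W))
    (hs : ∀ a ∈ s, ∃ z ∈ B, IsReduction z a) {a : MonoidAlgebra ℂ W}
    (ha : a ∈ Algebra.adjoin ℂ s) : ∃ z ∈ B, IsReduction z a := by
  induction ha using Algebra.adjoin_induction with
  | mem a ha => exact hs a ha
  | algebraMap b => exact ⟨_, B.algebraMap_mem _, isReduction_algebraMap b⟩
  | add a b _ _ ha hb =>
    obtain ⟨z, hz, h⟩ := ha
    obtain ⟨z', hz', h'⟩ := hb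
    exact ⟨_, B.add_mem hz hz', h.add h'⟩
  | mul a b _ _ ha hb =>
    obtain ⟨z, hz, h⟩ := ha
    obtain ⟨z', hz', h'⟩ := hb
    exact ⟨_, B.mul_mem hz hz', h.mul h'⟩

end Reduction

/-! ### Jucys–Murphy elements as reductions of Gaudin operators -/

section JucysMurphy

variable {d n : ℕ} {c : Ref (G d n) → ℂ} {α : Ref (G d n) → Module.Dual ℂ (Fin n → ℂ)}

theorem IsRootChoice.apply_eq_zero_iff {W : Subgroup (GL (Fin n) ℂ)}
    {α : Ref W → Module.Dual ℂ (Fin n → ℂ)} (hα : IsRootChoice W α) (s : Ref W)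
    (v : Fin n → ℂ) : α s v = 0 ↔ (toMatrix s.1).mulVec v = v := by
  rw [← LinearMap.mem_ker, hα s, LinearMap.mem_ker, Matrix.mulVecLin_apply, Matrix.sub_mulVec,
    Matrix.one_mulVec, sub_eq_zero]

theorem IsRootChoice.ne_zero {W : Subgroup (GL (Fin n) ℂ)}
    {α : Ref W → Module.Dual ℂ (Fin n → ℂ)} (hα : IsRootChoice W α) (s : Ref W) : α s ≠ 0 := by
  intro h
  have h1 : toMatrix s.1 = 1 := by
    refine Matrix.ext_of_mulVec_single fun i => ?_
    rw [(hα.apply_eq_zero_iff s _).1 (by rw [h, LinearMap.zero_apply]), Matrix.one_mulVec]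
  have h2 : (toMatrix s.1 - 1).rank = 1 := s.2
  rw [h1, sub_self, Matrix.rank_zero] at h2
  exact zero_ne_one h2

/-- A reflection fixes a basis vector exactly when its root vanishes there, so the last coordinate
of the root decides membership. -/
theorem mem_subG_iff_lt (hα : IsRootChoice (G d n) α) (s : Ref (G d n)) {M : Fin n}
    (hM : IsLastCoord (α s) M) (k : ℕ) : (s : G d n) ∈ subG d n k ↔ (M : ℕ) < k := by
  refine ⟨fun h => ?_, fun h j hj => ?_⟩
  · by_contra hk
    exact hM.1 ((hα.apply_eq_zero_iff s _).2 (h M (not_lt.1 hk)))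
  · exact (hα.apply_eq_zero_iff s _).1 (hM.2 j (Fin.lt_def.2 (h.trans_le hj)))

open Classical in
theorem euler_eq_sum [Fintype (Ref (G d n))] (c : Ref (G d n) → ℂ) (k : ℕ) :
    euler c k = ∑ s : Ref (G d n), if (s : G d n) ∈ subG d n k then
      MonoidAlgebra.single (s : G d n) (c s * (toMatrix s.1).det) else 0 := by
  rw [euler, finsum_eq_sum_of_fintype]
  exact Finset.sum_congr rfl fun s _ => finsum_eq_if

theorem isReduction_gaudinOperator (hd : 0 < d) (hα : IsRootChoice (G d n) α) (k : Fin n) :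
    IsReduction (algebraMap (PolyV n) (RatV n) (MvPolynomial.X k) •
      gaudinOperator (G d n) c α (Pi.single k 1)) (jucysMurphy c k) := by
  classical
  have := G_finite d n hd
  have : Fintype (Ref (G d n)) := Fintype.ofFinite _
  rw [gaudinOperator, finsum_eq_sum_of_fintype, jucysMurphy, euler_eq_sum, euler_eq_sum,
    Finset.smul_sum, ← Finset.sum_sub_distrib]
  refine IsReduction.sum _ fun s _ => ?_
  obtain ⟨M, hM⟩ := exists_isLastCoord (hα.ne_zero s)
  -- With indices from `0`, the conditions `M < k + 1` and `M < k` differ only at `M = k`.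
  have e : ((if (s : G d n) ∈ subG d n (k + 1) then
        MonoidAlgebra.single (s : G d n) (c s * (toMatrix s.1).det) else 0) -
      if (s : G d n) ∈ subG d n k then
        MonoidAlgebra.single (s : G d n) (c s * (toMatrix s.1).det) else 0) =
      MonoidAlgebra.single (s : G d n) (if k = M then c s * (toMatrix s.1).det else 0) := by
    rw [mem_subG_iff_lt hα s hM, mem_subG_iff_lt hα s hM]
    rcases lt_trichotomy k M with h | rfl | h
    · have : (k : ℕ) < M := h
      rw [if_neg (by omega), if_neg (by omega), if_neg h.ne, MonoidAlgebra.single_zero, sub_zero]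
    · rw [if_pos (by omega), if_neg (by omega), if_pos rfl, sub_zero]
    · have : (M : ℕ) < k := h
      rw [if_pos (by omega), if_pos (by omega), if_neg h.ne', MonoidAlgebra.single_zero, sub_self]
  rw [e, MonoidAlgebra.smul_single, smul_eq_mul]
  exact isReduction_single _ (weightValuation_coeff_sub_lt_one hM _ k)

theorem gaudinOperator_mem_gaudinAlgebraRat {W : Subgroup (GL (Fin n) ℂ)} (c : Ref W → ℂ)
    (α : Ref W → Module.Dual ℂ (Fin n → ℂ)) (y : Fin n → ℂ) :
    gaudinOperator W c α y ∈ gaudinAlgebraRat W c α :=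
  Algebra.subset_adjoin (Algebra.subset_adjoin ⟨y, rfl⟩)

/-! ### Commutation of the Jucys–Murphy elements -/

theorem mul_mem_subG {k : ℕ} {v w : G d n} (hv : v ∈ subG d n k) (hw : w ∈ subG d n k) :
    v * w ∈ subG d n k := fun j hj => by
  rw [show toMatrix (v * w) = toMatrix v * toMatrix w from rfl, ← Matrix.mulVec_mulVec, hw j hj,
    hv j hj]

theorem inv_mem_subG {k : ℕ} {w : G d n} (hw : w ∈ subG d n k) : w⁻¹ ∈ subG d n k := fun j hj => by
  have h : toMatrix w⁻¹ * toMatrix w = 1 := by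
    change toMatrix (w⁻¹ * w) = 1
    rw [inv_mul_cancel]
    rfl
  conv_lhs => rw [← hw j hj, Matrix.mulVec_mulVec, h, Matrix.one_mulVec]

theorem subG_mono {j k : ℕ} (h : j ≤ k) : subG d n j ⊆ subG d n k :=
  fun _ hw i hi => hw i (h.trans hi)

theorem toMatrix_conj {W : Subgroup (GL (Fin n) ℂ)} (w s : W) :
    toMatrix (w * s * w⁻¹) = toMatrix w * toMatrix s * toMatrix w⁻¹ := rfl

theorem toMatrix_mul_inv {W : Subgroup (GL (Fin n) ℂ)} (w : W) :
    toMatrix w * toMatrix w⁻¹ = 1 := by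
  change toMatrix (w * w⁻¹) = 1
  rw [mul_inv_cancel]
  rfl

theorem isUnit_det_toMatrix {W : Subgroup (GL (Fin n) ℂ)} (w : W) : IsUnit (toMatrix w).det :=
  (Matrix.isUnit_iff_isUnit_det _).1 (Units.isUnit (w : GL (Fin n) ℂ))

theorem conj_mem_Ref {W : Subgroup (GL (Fin n) ℂ)} (w : W) {s : W} (hs : s ∈ Ref W) :
    w * s * w⁻¹ ∈ Ref W := by
  have h : toMatrix (w * s * w⁻¹) - 1 = toMatrix w * (toMatrix s - 1) * toMatrix w⁻¹ := by
    rw [toMatrix_conj, mul_sub, sub_mul, mul_one, toMatrix_mul_inv]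
  change (toMatrix (w * s * w⁻¹) - 1).rank = 1
  rw [h, Matrix.rank_mul_eq_left_of_isUnit_det _ _ (isUnit_det_toMatrix _),
    Matrix.rank_mul_eq_right_of_isUnit_det _ _ (isUnit_det_toMatrix _)]
  exact hs

/-- Conjugation acting on reflections. -/
def conjRef {W : Subgroup (GL (Fin n) ℂ)} (w : W) : Ref W ≃ Ref W where
  toFun s := ⟨w * s.1 * w⁻¹, conj_mem_Ref w s.2⟩
  invFun s := ⟨w⁻¹ * s.1 * w, by simpa using conj_mem_Ref w⁻¹ s.2⟩
  left_inv s := Subtype.ext (by group)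
  right_inv s := Subtype.ext (by group)

/-- Conjugation by `w` permutes the reflections of `G(d,1,k)` and preserves both `c` and `det`, so
it fixes the Euler element. -/
theorem commute_single_euler (hd : 0 < d) (hc : IsConjInvariant c) {k : ℕ} {w : G d n}
    (hw : w ∈ subG d n k) (a : ℂ) : Commute (MonoidAlgebra.single w a) (euler c k) := by
  classical
  have := G_finite d n hd
  have : Fintype (Ref (G d n)) := Fintype.ofFinite _
  rw [euler_eq_sum, commute_iff_eq, Finset.mul_sum, Finset.sum_mul,
    ← Equiv.sum_comp (conjRef w) fun s => (if (s : G d n) ∈ subG d n k then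
      MonoidAlgebra.single (s : G d n) (c s * (toMatrix s.1).det) else 0) *
        MonoidAlgebra.single w a]
  refine Finset.sum_congr rfl fun s _ => ?_
  have hcs : c (conjRef w s) = c s := hc _ _ (isConj_iff.2 ⟨w⁻¹, by simp [conjRef, mul_assoc]⟩)
  have hdet : (toMatrix (conjRef w s).1).det = (toMatrix s.1).det := by
    change (toMatrix (w * s.1 * w⁻¹)).det = _
    rw [toMatrix_conj, Matrix.det_mul, Matrix.det_mul, mul_right_comm, ← Matrix.det_mul,
      toMatrix_mul_inv, Matrix.det_one, one_mul]
  have hmem : (conjRef w s : G d n) ∈ subG d n k ↔ (s : G d n) ∈ subG d n k := by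
    refine ⟨fun h => ?_, fun h => mul_mem_subG (mul_mem_subG hw h) (inv_mem_subG hw)⟩
    have := mul_mem_subG (mul_mem_subG (inv_mem_subG hw) h) hw
    simpa [conjRef, mul_assoc] using this
  rw [hcs, hdet, if_congr hmem rfl rfl]
  split_ifs
  · rw [MonoidAlgebra.single_mul_single, MonoidAlgebra.single_mul_single, mul_comm a]
    congr 1
    simp [conjRef]
  · rw [mul_zero, zero_mul]

/-- The smaller Euler element is supported on `G(d,1,j) ⊆ G(d,1,k)`, each element of which commutes
with the larger one. -/
theorem commute_euler_of_le (hd : 0 < d) (hc : IsConjInvariant c) {j k : ℕ} (h : j ≤ k) :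
    Commute (euler c j) (euler c k) := by
  classical
  have := G_finite d n hd
  have : Fintype (Ref (G d n)) := Fintype.ofFinite _
  rw [euler_eq_sum c j]
  refine Commute.sum_left _ _ _ fun s _ => ?_
  split_ifs with hs
  · exact commute_single_euler hd hc (subG_mono h hs) _
  · exact Commute.zero_left _

theorem commute_euler (hd : 0 < d) (hc : IsConjInvariant c) (j k : ℕ) :
    Commute (euler c j) (euler c k) :=
  (le_total j k).elim (commute_euler_of_le hd hc) fun h => (commute_euler_of_le hd hc h).symm

theorem jmAlgebra_mul_comm (hd : 0 < d) (hc : IsConjInvariant c) (a b : jmAlgebra c) :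
    a * b = b * a := by
  have h : ∀ x ∈ Set.range (jucysMurphy c), ∀ y ∈ Set.range (jucysMurphy c), x * y = y * x := by
    rintro _ ⟨j, rfl⟩ _ ⟨k, rfl⟩
    have H := commute_euler hd hc
    exact (((H _ _).sub_left (H _ _)).sub_right ((H _ _).sub_left (H _ _))).eq
  exact (Algebra.isMulCommutative_adjoin ℂ h).is_comm.comm a b

end JucysMurphy

end CalogeroMoser

end

theorem mainTheorem4 (d n : ℕ) (hd : 0 < d)
    (c : CalogeroMoser.Ref (CalogeroMoser.G d n) → ℂ)
    (hc : CalogeroMoser.IsConjInvariant c)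
    (α : CalogeroMoser.Ref (CalogeroMoser.G d n) → Module.Dual ℂ (Fin n → ℂ))
    (hα : CalogeroMoser.IsRootChoice (CalogeroMoser.G d n) α)
    (γ : CalogeroMoser.G d n → ℂ)
    (hγ : CalogeroMoser.IsCellularCharacter (CalogeroMoser.jmAlgebra c) γ) :
    ∃ m : Multiset (CalogeroMoser.G d n → ℂ),
      (∀ ψ ∈ m, CalogeroMoser.IsCMCellularCharacter (CalogeroMoser.G d n) c α ψ) ∧
        γ = m.sum := by
  have := CalogeroMoser.G_finite d n hd
  refine CalogeroMoser.IsCellularCharacter.exists_multiset_of_specialization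
    (IsScalarTower.toAlgHom ℂ (CalogeroMoser.weightRing n) (CalogeroMoser.weightResidue n))
    (CalogeroMoser.jmAlgebra c) (CalogeroMoser.jmAlgebra_mul_comm hd hc)
    (CalogeroMoser.gaudinAlgebraRat (CalogeroMoser.G d n) c α) (fun a ha => ?_) hγ
  obtain ⟨_, hz, z, rfl, h⟩ := CalogeroMoser.exists_mem_isReduction_of_adjoin
    (CalogeroMoser.gaudinAlgebraRat (CalogeroMoser.G d n) c α) (by
      rintro _ ⟨k, rfl⟩
      -- The lift of `J_k` is `x_k 𝒟_{y_k}`; the factor `x_k` is a scalar of `ℂ(V)`.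
      exact ⟨_, Subalgebra.smul_mem _
        (CalogeroMoser.gaudinOperator_mem_gaudinAlgebraRat c α _) _,
        CalogeroMoser.isReduction_gaudinOperator hd hα k⟩) ha
  exact ⟨z, hz, h⟩
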